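/- There exist absolute constants $C, c > 0$ with the following property. Let $d \ge 1$ and $N$ be integers and let $0<\varepsilon<1$ be such that $N \ge C d/\varepsilon^2$. Let $U_1,\dots,U_N$ be independent random matrices, each Haar-distributed on the unitary group $\mathcal{U}(d)$, and let $\Phi$ be the random quantum channel on the complex $d\times d$ matrices given by \[ \Phi(\rho) = \frac1N \sum_{i=1}^N U_i \rho U_i^\dagger . \] Call a quantum channel (a completely positive, trace-preserving linear map) $\Psi$ on the complex $d \times d$ matrices $\varepsilon$-randomizing if $\|\Psi(\rho) - \mathrm{Id}/d\|_\infty \le \varepsilon/d$ for every state $\rho$ (positive semidefinite matrix of trace $1$), where $\|\cdot\|_\infty$ is the operator norm. Then $\Phi$ is $\varepsilon$-randomizing with nonzero probability; in fact, the probability that $\Phi$ is not $\varepsilon$-randomizing is at most $e^{-cd}$. -/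

import Mathlib

open MeasureTheory ProbabilityTheory
open scoped ComplexOrder

/-- The unitary group `U(d)` carries its Borel σ-algebra. -/
noncomputable instance unitaryGroupMeasurableSpace (d : ℕ) :
    MeasurableSpace (Matrix.unitaryGroup (Fin d) ℂ) :=
  borel _

instance unitaryGroupBorelSpace (d : ℕ) :
    BorelSpace (Matrix.unitaryGroup (Fin d) ℂ) :=
  ⟨rfl⟩

/-- A random unitary matrix `V` on the probability space `(Ω, P)` is Haar-distributed if its law
is a Haar measure on `U(d)`; as `P` is a probability measure, so is the law. -/
structure IsHaarDistributed {Ω : Type*} [MeasurableSpace Ω] {d : ℕ}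
    (V : Ω → Matrix.unitaryGroup (Fin d) ℂ) (P : Measure Ω) : Prop where
  measurable : Measurable V
  isHaar : (P.map V).IsHaarMeasure

/-- A state on `ℂ^d`: a positive semidefinite matrix of trace one. -/
structure IsState {d : ℕ} (ρ : Matrix (Fin d) (Fin d) ℂ) : Prop where
  posSemidef : ρ.PosSemidef
  trace_eq_one : ρ.trace = 1

/-- The maximally mixed state `Id / d`. -/
noncomputable def maxMixed (d : ℕ) : Matrix (Fin d) (Fin d) ℂ :=
  (d : ℂ)⁻¹ • (1 : Matrix (Fin d) (Fin d) ℂ)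

/-- The map `Φ ⊗ Id` on `M(ℂ^d ⊗ ℂ^k)`: it applies `Φ` to each of the `k × k` blocks
`(X (·, a) (·, b))`, which lie in `M(ℂ^d)`. -/
def amplify {d : ℕ} (Φ : Matrix (Fin d) (Fin d) ℂ →ₗ[ℂ] Matrix (Fin d) (Fin d) ℂ) (k : ℕ)
    (X : Matrix (Fin d × Fin k) (Fin d × Fin k) ℂ) :
    Matrix (Fin d × Fin k) (Fin d × Fin k) ℂ :=
  Matrix.of fun p q => Φ (Matrix.of fun i j => X (i, p.2) (j, q.2)) p.1 q.1

/-- A quantum channel: a completely positive, trace-preserving linear map. -/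
structure IsQuantumChannel {d : ℕ}
    (Φ : Matrix (Fin d) (Fin d) ℂ →ₗ[ℂ] Matrix (Fin d) (Fin d) ℂ) : Prop where
  completelyPositive : ∀ (k : ℕ) (X : Matrix (Fin d × Fin k) (Fin d × Fin k) ℂ),
    X.PosSemidef → (amplify Φ k X).PosSemidef
  trace_preserving : ∀ X : Matrix (Fin d) (Fin d) ℂ, (Φ X).trace = X.trace

open scoped Matrix.Norms.L2Operator in
/-- `Φ` is an `ε`-randomizing channel: a quantum channel that maps every state to within `ε / d` of
the maximally mixed state. The norm is the operator norm on `ℂ^d` with its Euclidean norm. -/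
structure IsRandomizing {d : ℕ}
    (Φ : Matrix (Fin d) (Fin d) ℂ →ₗ[ℂ] Matrix (Fin d) (Fin d) ℂ) (ε : ℝ) : Prop where
  isQuantumChannel : IsQuantumChannel Φ
  norm_sub_le : ∀ ρ : Matrix (Fin d) (Fin d) ℂ, IsState ρ → ‖Φ ρ - maxMixed d‖ ≤ ε / d

/-- The map `Φ(ρ) = (1 / N) ∑ᵢ Uᵢ ρ Uᵢ†`. -/
noncomputable def averageConj {d N : ℕ} (U : Fin N → Matrix.unitaryGroup (Fin d) ℂ) :
    Matrix (Fin d) (Fin d) ℂ →ₗ[ℂ] Matrix (Fin d) (Fin d) ℂ where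
  toFun ρ := (N : ℂ)⁻¹ • ∑ i, (U i : Matrix (Fin d) (Fin d) ℂ) * ρ *
    (U i : Matrix (Fin d) (Fin d) ℂ).conjTranspose
  map_add' ρ σ := by
    simp only [Matrix.mul_add, Matrix.add_mul, Finset.sum_add_distrib, smul_add]
  map_smul' a ρ := by
    simp only [Matrix.mul_smul, Matrix.smul_mul, ← Finset.smul_sum, RingHom.id_apply]
    exact smul_comm _ _ _

/-! By the spectral decomposition of states and self-adjointness, it suffices that `deviation U φ
ψ`, the form `⟪ψ, (Φ(φφ†) - Id / d) ψ⟫`, is at most `ε / d` in absolute value for all unit vectors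
`φ`, `ψ`.

For fixed `φ`, `ψ` and Haar-distributed `V`, the variable `d |⟪ψ, Vφ⟫|²` has mean `1` and
exponential moments bounded uniformly in `d` (`integral_exp_transitionProb_le`). By invariance `ψ`
may be averaged over the flat sign vectors, and a sign sum is exponentially square integrable.
Bernstein's inequality then bounds the probability of a deviation above `ε / (2d)` by `2 exp(-c N
ε²)`.

A union bound over pairs from a net of the sphere costs a factor exponential in `d`, which `N ≥ C d
/ ε²` absorbs. A net of constant mesh `1/8` suffices, and no logarithm is lost, because the
Lipschitz constant of the form is proportional to its own supremum (`abs_le_two_mul_of_net`). -/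

/-! ### Nets of the unit sphere. -/

/-- Volume bound: a `δ`-separated subset of the unit ball of a finite-dimensional real normed space
has at most `(1 + 2 / δ) ^ dim` points. -/
theorem card_le_of_separated_unitBall {E : Type*} [NormedAddCommGroup E] [NormedSpace ℝ E]
    [FiniteDimensional ℝ E] {δ : ℝ} (hδ : 0 < δ) (s : Finset E) (hs : ∀ c ∈ s, ‖c‖ ≤ 1)
    (h : ∀ c ∈ s, ∀ e ∈ s, c ≠ e → δ ≤ ‖c - e‖) :
    (s.card : ℝ) ≤ (1 + 2 / δ) ^ Module.finrank ℝ E := by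
  borelize E
  let μ : Measure E := Measure.addHaar
  have hr : 0 < δ / 2 := by positivity
  have hR : 0 < 1 + δ / 2 := by positivity
  have hdisj : Set.Pairwise (s : Set E)
      (Function.onFun Disjoint fun c => Metric.ball (c : E) (δ / 2)) := by
    rintro c hc e he hce
    apply Metric.ball_disjoint_ball
    rw [dist_eq_norm]
    linarith [h c hc e he hce]
  have hsub : (⋃ c ∈ s, Metric.ball (c : E) (δ / 2)) ⊆ Metric.ball (0 : E) (1 + δ / 2) := by
    refine Set.iUnion₂_subset fun x hx => Metric.ball_subset_ball' ?_
    rw [dist_zero_right]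
    linarith [hs x hx]
  have hvol : (s.card : ENNReal) * ENNReal.ofReal ((δ / 2) ^ Module.finrank ℝ E) *
      μ (Metric.ball 0 1) ≤
      ENNReal.ofReal ((1 + δ / 2) ^ Module.finrank ℝ E) * μ (Metric.ball 0 1) :=
    calc
      _ = μ (⋃ c ∈ s, Metric.ball (c : E) (δ / 2)) := by
        rw [measure_biUnion_finset hdisj fun c _ => measurableSet_ball]
        simp only [μ.addHaar_ball_of_pos _ hr, Finset.sum_const, nsmul_eq_mul, mul_assoc]
      _ ≤ μ (Metric.ball (0 : E) (1 + δ / 2)) := measure_mono hsub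
      _ = _ := by simp only [μ.addHaar_ball_of_pos _ hR]
  have hcard := (ENNReal.mul_le_mul_iff_left (Metric.measure_ball_pos _ _ zero_lt_one).ne'
    measure_ball_lt_top.ne).1 hvol
  have hreal := ENNReal.toReal_le_of_le_ofReal (by positivity) hcard
  rw [ENNReal.toReal_mul, ENNReal.toReal_natCast, ENNReal.toReal_ofReal (by positivity)] at hreal
  rw [show 1 + 2 / δ = (1 + δ / 2) / (δ / 2) by field_simp; ring, div_pow,
    le_div_iff₀ (by positivity)]
  exact hreal

/-- The unit sphere of a finite-dimensional real normed space has a `δ`-net with at most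
`(1 + 2 / δ) ^ dim` points. -/
theorem exists_finset_net_unitSphere (E : Type*) [NormedAddCommGroup E] [NormedSpace ℝ E]
    [FiniteDimensional ℝ E] {δ : ℝ} (hδ : 0 < δ) :
    ∃ s : Finset E, (∀ c ∈ s, ‖c‖ = 1) ∧ (s.card : ℝ) ≤ (1 + 2 / δ) ^ Module.finrank ℝ E ∧
      ∀ x : E, ‖x‖ = 1 → ∃ y ∈ s, ‖x - y‖ ≤ δ := by
  classical
  -- A separated set of maximal cardinality is a net: a point far from all of it could be added. The
  -- volume bound makes the maximum exist.
  let S : Set ℕ := {n | ∃ s : Finset E, s.card = n ∧ (∀ c ∈ s, ‖c‖ = 1) ∧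
    ∀ c ∈ s, ∀ e ∈ s, c ≠ e → δ ≤ ‖c - e‖}
  have hne : S.Nonempty := ⟨0, ∅, by simp⟩
  have hbdd : BddAbove S := by
    refine ⟨⌊(1 + 2 / δ) ^ Module.finrank ℝ E⌋₊, ?_⟩
    rintro n ⟨s, rfl, h1, h2⟩
    exact Nat.le_floor (card_le_of_separated_unitBall hδ s (fun c hc => (h1 c hc).le) h2)
  obtain ⟨s, hcard, h1, h2⟩ := Nat.sSup_mem hne hbdd
  refine ⟨s, h1, card_le_of_separated_unitBall hδ s (fun c hc => (h1 c hc).le) h2, ?_⟩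
  intro x hx
  by_contra! hfar
  have hxs : x ∉ s := fun hmem => by
    have := hfar x hmem
    simp at this
    linarith
  have hmem : (insert x s).card ∈ S := by
    refine ⟨insert x s, rfl, ?_, ?_⟩
    · simpa [hx] using h1
    · intro c hc e he hce
      rw [Finset.mem_insert] at hc he
      rcases hc with rfl | hc <;> rcases he with rfl | he
      · exact absurd rfl hce
      · exact (hfar e he).le
      · rw [norm_sub_rev]; exact (hfar c hc).le
      · exact h2 c hc e he hce
  have := le_csSup hbdd hmem
  rw [Finset.card_insert_of_notMem hxs] at this
  omega

/-! ### Quadratic forms: from a net to the whole sphere. -/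

section SymmetricForm

variable {E : Type*} [NormedAddCommGroup E] [InnerProductSpace ℂ E]

/-- A symmetric operator whose quadratic form is bounded by `B` on the unit sphere has norm at
most `B`. -/
theorem norm_le_of_abs_re_inner_le {T : E →L[ℂ] E} (hT : (T : E →ₗ[ℂ] E).IsSymmetric) {B : ℝ}
    (hB : 0 ≤ B) (h : ∀ x, ‖x‖ = 1 → |RCLike.re (inner ℂ (T x) x)| ≤ B) : ‖T‖ ≤ B := by
  rw [T.norm_eq_iSup_rayleighQuotient hT]
  refine ciSup_le fun x => ?_
  rcases eq_or_ne x 0 with rfl | hx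
  · simpa using hB
  have hx' : (‖x‖⁻¹ : ℂ) ≠ 0 := by simpa using hx
  rw [← T.rayleigh_smul x hx']
  have hn : ‖(‖x‖⁻¹ : ℂ) • x‖ = 1 := norm_smul_inv_norm hx
  rw [ContinuousLinearMap.rayleighQuotient, hn, ContinuousLinearMap.reApplyInnerSelf_apply]
  simpa using h _ hn

/-- A difference of squares: by symmetry the cross terms cancel, leaving `re ⟪T (x - y), x + y⟫`. -/
theorem abs_re_inner_sub_le {T : E →L[ℂ] E} (hT : (T : E →ₗ[ℂ] E).IsSymmetric) (x y : E) :
    |RCLike.re (inner ℂ (T x) x) - RCLike.re (inner ℂ (T y) y)| ≤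
      ‖T‖ * (‖x - y‖ * ‖x + y‖) := by
  have hsymm : RCLike.re (inner ℂ (T x) y) = RCLike.re (inner ℂ (T y) x) := by
    have h := hT x y
    simp only [ContinuousLinearMap.coe_coe] at h
    rw [h, ← inner_conj_symm, RCLike.conj_re]
  have hpolar : RCLike.re (inner ℂ (T x) x) - RCLike.re (inner ℂ (T y) y) =
      RCLike.re (inner ℂ (T (x - y)) (x + y)) := by
    simp only [map_sub, inner_sub_left, inner_add_right, map_add]
    linarith
  rw [hpolar]
  calc _ ≤ ‖inner ℂ (T (x - y)) (x + y)‖ := RCLike.abs_re_le_norm _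
    _ ≤ ‖T (x - y)‖ * ‖x + y‖ := norm_inner_le_norm _ _
    _ ≤ (‖T‖ * ‖x - y‖) * ‖x + y‖ := by gcongr; exact T.le_opNorm _
    _ = _ := by ring

/-- The quadratic form `x ↦ w ∑ᵢ |⟪aᵢ, x⟫|² - k ‖x‖²`, if bounded by `B` on the unit sphere, is
`2 B`-Lipschitz there. -/
theorem abs_frame_form_sub_le {ι : Type*} [Fintype ι] (a : ι → E) (w k : ℝ) {B : ℝ} (hB : 0 ≤ B)
    (h : ∀ x, ‖x‖ = 1 → |w * ∑ i, ‖inner ℂ (a i) x‖ ^ 2 - k * ‖x‖ ^ 2| ≤ B)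
    {x y : E} (hx : ‖x‖ = 1) (hy : ‖y‖ = 1) :
    |(w * ∑ i, ‖inner ℂ (a i) x‖ ^ 2 - k * ‖x‖ ^ 2) -
      (w * ∑ i, ‖inner ℂ (a i) y‖ ^ 2 - k * ‖y‖ ^ 2)| ≤ 2 * B * ‖x - y‖ := by
  -- The form belongs to a symmetric operator, so its bound on the sphere bounds `‖T‖`, and hence
  -- its own Lipschitz constant; the factor `2` is `‖x + y‖ ≤ 2`.
  let T : E →L[ℂ] E := (w : ℂ) • ∑ i, InnerProductSpace.rankOne ℂ (a i) (a i) -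
    (k : ℂ) • ContinuousLinearMap.id ℂ E
  have hTapp (z : E) : T z = (w : ℂ) • ∑ i, inner ℂ (a i) z • a i - (k : ℂ) • z := by
    simp [T]
  have hTsymm : (T : E →ₗ[ℂ] E).IsSymmetric := by
    intro u v
    simp only [ContinuousLinearMap.coe_coe, hTapp, inner_sub_left, inner_sub_right,
      inner_smul_left, inner_smul_right, sum_inner, inner_sum, Complex.conj_ofReal]
    congr 2
    refine Finset.sum_congr rfl fun i _ => ?_
    rw [inner_conj_symm, mul_comm]
  have hTform (z : E) : RCLike.re (inner ℂ (T z) z) =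
      w * ∑ i, ‖inner ℂ (a i) z‖ ^ 2 - k * ‖z‖ ^ 2 := by
    rw [hTapp, inner_sub_left, inner_smul_left, inner_smul_left, sum_inner,
      inner_self_eq_norm_sq_to_K]
    simp only [inner_smul_left, Complex.conj_ofReal]
    have (i : ι) : (starRingEnd ℂ) (inner ℂ (a i) z) * inner ℂ (a i) z =
        ((‖inner ℂ (a i) z‖ ^ 2 : ℝ) : ℂ) := by
      rw [RCLike.conj_mul]; push_cast; rfl
    simp only [this]
    rw [← Complex.ofReal_sum]
    have h2 : ((‖z‖ : ℂ)) ^ 2 = ((‖z‖ ^ 2 : ℝ) : ℂ) := by push_cast; rfl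
    change ((w : ℂ) * _ - (k : ℂ) * (‖z‖ : ℂ) ^ 2).re = _
    rw [h2, ← Complex.ofReal_mul, ← Complex.ofReal_mul, ← Complex.ofReal_sub, Complex.ofReal_re]
  have hTnorm : ‖T‖ ≤ B := norm_le_of_abs_re_inner_le hTsymm hB fun z hz => by
    rw [hTform]; exact h z hz
  have hsum : ‖x + y‖ ≤ 2 := (norm_add_le _ _).trans (by rw [hx, hy]; norm_num)
  rw [← hTform, ← hTform]
  calc _ ≤ ‖T‖ * (‖x - y‖ * ‖x + y‖) := abs_re_inner_sub_le hTsymm x y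
    _ ≤ B * (‖x - y‖ * 2) := by gcongr
    _ = _ := by ring

end SymmetricForm

/-- A form that is Lipschitz in each argument with constant proportional to its own supremum is
controlled by its values on a net. -/
theorem abs_le_two_mul_of_net {E : Type*} [NormedAddCommGroup E] (Q : E → E → ℝ) {A B₀ : ℝ}
    (hbdd : ∀ x y, ‖x‖ = 1 → ‖y‖ = 1 → |Q x y| ≤ B₀)
    (hleft : ∀ B, 0 ≤ B → (∀ x y, ‖x‖ = 1 → ‖y‖ = 1 → |Q x y| ≤ B) →
      ∀ x x' y, ‖x‖ = 1 → ‖x'‖ = 1 → ‖y‖ = 1 → |Q x y - Q x' y| ≤ 2 * B * ‖x - x'‖)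
    (hright : ∀ B, 0 ≤ B → (∀ x y, ‖x‖ = 1 → ‖y‖ = 1 → |Q x y| ≤ B) →
      ∀ x y y', ‖x‖ = 1 → ‖y‖ = 1 → ‖y'‖ = 1 → |Q x y - Q x y'| ≤ 2 * B * ‖y - y'‖)
    (s : Finset E) (hs : ∀ c ∈ s, ‖c‖ = 1) (hnet : ∀ x : E, ‖x‖ = 1 → ∃ y ∈ s, ‖x - y‖ ≤ 1 / 8)
    (hA : ∀ x ∈ s, ∀ y ∈ s, |Q x y| ≤ A) {x y : E} (hx : ‖x‖ = 1) (hy : ‖y‖ = 1) :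
    |Q x y| ≤ 2 * A := by
  let V : Set ℝ := {r | ∃ x y, ‖x‖ = 1 ∧ ‖y‖ = 1 ∧ r = |Q x y|}
  -- The a priori bound `B₀` serves only to make the supremum finite; its value does not enter the
  -- conclusion.
  have hV : BddAbove V := ⟨B₀, by rintro _ ⟨x, y, hx, hy, rfl⟩; exact hbdd x y hx hy⟩
  have hle : ∀ x y, ‖x‖ = 1 → ‖y‖ = 1 → |Q x y| ≤ sSup V :=
    fun x y hx hy => le_csSup hV ⟨x, y, hx, hy, rfl⟩
  have h0 : 0 ≤ sSup V := (abs_nonneg _).trans (hle x y hx hy)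
  -- Moving each argument to the net costs `2 * sSup V / 8`, so both together cost half the
  -- supremum, which is absorbed on the left.
  have hsup : sSup V ≤ A + sSup V / 2 := by
    refine csSup_le ⟨_, x, y, hx, hy, rfl⟩ ?_
    rintro _ ⟨u, v, hu, hv, rfl⟩
    obtain ⟨u', hu's, hu'⟩ := hnet u hu
    obtain ⟨v', hv's, hv'⟩ := hnet v hv
    have e1 := hleft _ h0 hle u u' v hu (hs _ hu's) hv
    have e2 := hright _ h0 hle u' v v' (hs _ hu's) hv (hs _ hv's)
    have e3 := hA u' hu's v' hv's
    have t1 : 2 * sSup V * ‖u - u'‖ ≤ 2 * sSup V * (1 / 8) := by gcongr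
    have t2 : 2 * sSup V * ‖v - v'‖ ≤ 2 * sSup V * (1 / 8) := by gcongr
    have t3 : |Q u v| ≤ |Q u v - Q u' v| + (|Q u' v - Q u' v'| + |Q u' v'|) := by
      calc |Q u v| = |(Q u v - Q u' v) + ((Q u' v - Q u' v') + Q u' v')| := by ring_nf
        _ ≤ _ := (abs_add_le _ _).trans (by gcongr; exact abs_add_le _ _)
    linarith
  linarith [hle x y hx hy]

/-! ### Bernstein's inequality. -/

theorem Real.exp_le_one_add_add_sq_mul_exp_abs (x : ℝ) :
    Real.exp x ≤ 1 + x + x ^ 2 * Real.exp |x| := by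
  have he : 1 + |x| ≤ Real.exp |x| := by linarith [Real.add_one_le_exp |x|]
  rcases le_total |x| 1 with hx | hx
  · have h1 := (abs_le.1 (Real.abs_exp_sub_one_sub_id_le hx)).2
    nlinarith [sq_nonneg x, abs_nonneg x, mul_nonneg (sq_nonneg x) (abs_nonneg x)]
  · rcases le_total 0 x with h0 | h0
    · rw [abs_of_nonneg h0] at *
      nlinarith [Real.exp_pos x, mul_le_mul hx hx zero_le_one (by linarith)]
    · rw [abs_of_nonpos h0] at *
      have h1 : Real.exp x ≤ 1 := Real.exp_le_one_iff.2 h0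
      have h2 : 1 ≤ x ^ 2 := by nlinarith
      nlinarith [mul_le_mul_of_nonneg_left he (sq_nonneg x), mul_nonneg (sub_nonneg.2 h2)
        (sub_nonneg.2 hx)]

section Bernstein

variable {Ω : Type*} [MeasurableSpace Ω] {P : Measure Ω} [IsProbabilityMeasure P]

theorem integrable_of_abs_le {X : Ω → ℝ} (hX : Measurable X) {R : ℝ} (hR : ∀ ω, |X ω| ≤ R) :
    Integrable X P :=
  Integrable.of_bound hX.aestronglyMeasurable R (ae_of_all _ hR)

theorem integrable_exp_mul_of_abs_le {X : Ω → ℝ} (hX : Measurable X) {R : ℝ}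
    (hR : ∀ ω, |X ω| ≤ R) (l : ℝ) : Integrable (fun ω => Real.exp (l * X ω)) P := by
  refine integrable_of_abs_le (by fun_prop) (R := Real.exp (|l| * R)) fun ω => ?_
  rw [abs_of_pos (Real.exp_pos _), Real.exp_le_exp]
  calc l * X ω ≤ |l * X ω| := le_abs_self _
    _ = |l| * |X ω| := abs_mul _ _
    _ ≤ |l| * R := by gcongr; exact hR ω

/-- A bounded centred random variable with `E exp (s |Z|) ≤ M` is sub-exponential. -/
theorem mgf_le_exp_of_integral_exp_abs_le {Z : Ω → ℝ} (hZ : Measurable Z) {R : ℝ}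
    (hR : ∀ ω, |Z ω| ≤ R) (hmean : ∫ ω, Z ω ∂P = 0) {s M : ℝ} (hs : 0 < s)
    (hM : ∫ ω, Real.exp (s * |Z ω|) ∂P ≤ M) {l : ℝ} (hl : |l| ≤ s / 2) :
    mgf Z P l ≤ Real.exp (8 * M / s ^ 2 * l ^ 2) := by
  have hIZ : Integrable Z P := integrable_of_abs_le hZ hR
  have hIe : Integrable (fun ω => Real.exp (s * |Z ω|)) P :=
    integrable_exp_mul_of_abs_le (R := R) (by fun_prop) (by simpa using hR) s
  -- The exponent `s |z|` is split in halves: one dominates `z ^ 2`, the other dominates `exp |l z|`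
  -- since `|l| ≤ s / 2`. The linear term is kept because it integrates to zero.
  have hpt (z : ℝ) : Real.exp (l * z) ≤ 1 + l * z + 8 / s ^ 2 * l ^ 2 * Real.exp (s * |z|) := by
    have h1 := Real.exp_le_one_add_add_sq_mul_exp_abs (l * z)
    have h2 : Real.exp |l * z| ≤ Real.exp (s / 2 * |z|) := by
      rw [Real.exp_le_exp, abs_mul]; gcongr
    have h3 : (s / 2 * |z|) ^ 2 / 2 ≤ Real.exp (s / 2 * |z|) := by
      have h0 : 0 ≤ s / 2 * |z| := by positivity
      linarith [Real.quadratic_le_exp_of_nonneg h0]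
    have h4 : z ^ 2 ≤ 8 / s ^ 2 * Real.exp (s / 2 * |z|) := by
      rw [div_mul_eq_mul_div, le_div_iff₀ (by positivity)]
      rw [mul_pow, sq_abs] at h3
      linarith
    have h5 : Real.exp (s * |z|) = Real.exp (s / 2 * |z|) * Real.exp (s / 2 * |z|) := by
      rw [← Real.exp_add]; ring_nf
    have h6 : (l * z) ^ 2 * Real.exp |l * z| ≤ 8 / s ^ 2 * l ^ 2 * Real.exp (s * |z|) :=
      calc (l * z) ^ 2 * Real.exp |l * z| = l ^ 2 * (z ^ 2 * Real.exp |l * z|) := by ring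
        _ ≤ l ^ 2 * ((8 / s ^ 2 * Real.exp (s / 2 * |z|)) * Real.exp (s / 2 * |z|)) := by gcongr
        _ = _ := by rw [h5]; ring
    linarith
  have hlin : Integrable (fun ω => 1 + l * Z ω) P := (integrable_const 1).add (hIZ.const_mul l)
  have hInt : Integrable (fun ω => 1 + l * Z ω + 8 / s ^ 2 * l ^ 2 * Real.exp (s * |Z ω|)) P :=
    hlin.add (hIe.const_mul _)
  calc mgf Z P l ≤ ∫ ω, (1 + l * Z ω + 8 / s ^ 2 * l ^ 2 * Real.exp (s * |Z ω|)) ∂P :=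
        integral_mono (integrable_exp_mul_of_abs_le hZ hR l) hInt fun ω => hpt (Z ω)
    _ = 1 + 8 / s ^ 2 * l ^ 2 * ∫ ω, Real.exp (s * |Z ω|) ∂P := by
        rw [integral_add hlin (hIe.const_mul _),
          integral_add (integrable_const 1) (hIZ.const_mul l), integral_const_mul,
          integral_const_mul, hmean]
        simp
    _ ≤ 1 + 8 / s ^ 2 * l ^ 2 * M := by gcongr
    _ ≤ Real.exp (8 / s ^ 2 * l ^ 2 * M) := by
        linarith [Real.add_one_le_exp (8 / s ^ 2 * l ^ 2 * M)]
    _ = _ := by ring_nf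

/-- Chernoff's method; `l = t / (2 * K)` minimises `K l² - l t`, with minimum `-t² / (4 K)`. -/
theorem measureReal_sum_ge_le {N : ℕ} {Z : Fin N → Ω → ℝ} (hZ : ∀ i, Measurable (Z i)) {R : ℝ}
    (hR : ∀ i ω, |Z i ω| ≤ R) (hind : iIndepFun Z P) {K t : ℝ} (hK : 0 < K) (ht : 0 ≤ t)
    (hmgf : ∀ i, mgf (Z i) P (t / (2 * K)) ≤ Real.exp (K * (t / (2 * K)) ^ 2)) :
    P.real {ω | N * t ≤ ∑ i, Z i ω} ≤ Real.exp (-(N * t ^ 2 / (4 * K))) := by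
  have hInt : Integrable (fun ω => Real.exp (t / (2 * K) * (∑ i, Z i) ω)) P := by
    refine integrable_exp_mul_of_abs_le (R := N * R) (by fun_prop) (fun ω => ?_) _
    rw [Finset.sum_apply]
    refine (Finset.abs_sum_le_sum_abs _ _).trans
      ((Finset.sum_le_sum fun i _ => hR i ω).trans (by simp))
  have h := measure_ge_le_exp_mul_mgf (μ := P) (X := ∑ i, Z i) (t := t / (2 * K)) (N * t)
    (by positivity) hInt
  rw [hind.mgf_sum hZ] at h
  simp only [Finset.sum_apply] at h
  calc _ ≤ _ := h
    _ ≤ Real.exp (-(t / (2 * K)) * (N * t)) * ∏ _i : Fin N, Real.exp (K * (t / (2 * K)) ^ 2) := by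
        gcongr with i
        · exact fun i _ => mgf_nonneg
        · exact hmgf i
    _ = _ := by
        rw [Finset.prod_const, Finset.card_univ, Fintype.card_fin, ← Real.exp_nat_mul,
          ← Real.exp_add]
        congr 1
        field_simp
        ring

/-- Bernstein's inequality for bounded centred independent variables with a uniform exponential
moment `E exp (s |Zᵢ|) ≤ M`. -/
theorem measureReal_abs_sum_ge_le {N : ℕ} {Z : Fin N → Ω → ℝ} (hZ : ∀ i, Measurable (Z i)) {R : ℝ}
    (hR : ∀ i ω, |Z i ω| ≤ R) (hind : iIndepFun Z P) (hmean : ∀ i, ∫ ω, Z i ω ∂P = 0) {s M t : ℝ}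
    (hs : 0 < s) (hs1 : s ≤ 1) (hM1 : 1 ≤ M) (hM : ∀ i, ∫ ω, Real.exp (s * |Z i ω|) ∂P ≤ M)
    (ht : 0 ≤ t) (ht1 : t ≤ 1) :
    P.real {ω | N * t ≤ |∑ i, Z i ω|} ≤ 2 * Real.exp (-(N * t ^ 2 / (4 * (8 * M / s ^ 2)))) := by
  set K := 8 * M / s ^ 2 with hKdef
  have hK : 0 < K := by positivity
  -- The optimal parameter stays in the range of the moment bound because `t`, `s ≤ 1 ≤ M`.
  have hl : |t / (2 * K)| ≤ s / 2 := by
    rw [abs_of_nonneg (by positivity), div_le_iff₀ (by positivity), hKdef]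
    have : s / 2 * (2 * (8 * M / s ^ 2)) = 8 * M / s := by field_simp
    rw [this, le_div_iff₀ hs]
    nlinarith
  have h1 := measureReal_sum_ge_le hZ hR hind hK ht fun i =>
    mgf_le_exp_of_integral_exp_abs_le (hZ i) (hR i) (hmean i) hs (hM i) hl
  have h2 := measureReal_sum_ge_le (Z := fun i ω => -Z i ω) (fun i => (hZ i).neg)
    (fun i ω => by simpa using hR i ω) (hind.comp (fun _ x => -x) fun _ => measurable_neg) hK ht
    fun i => mgf_le_exp_of_integral_exp_abs_le (hZ i).neg (fun ω => by simpa using hR i ω)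
      (by simpa [integral_neg] using hmean i) hs (by simpa using hM i) hl
  have hsub : {ω | N * t ≤ |∑ i, Z i ω|} ⊆
      {ω | N * t ≤ ∑ i, Z i ω} ∪ {ω | N * t ≤ ∑ i, -Z i ω} := by
    intro ω hω
    simpa [Finset.sum_neg_distrib, le_abs] using hω
  calc _ ≤ _ := measureReal_mono hsub
    _ ≤ _ := measureReal_union_le _ _
    _ ≤ _ := by linarith

end Bernstein

/-! ### Exponential square integrability of sign sums. -/

theorem gaussianPDFReal_mul_exp_sq_div_four (x : ℝ) :
    gaussianPDFReal 0 1 x * Real.exp (x ^ 2 / 4) =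
      (√(2 * Real.pi))⁻¹ * Real.exp (-(1 / 4) * x ^ 2) := by
  simp only [gaussianPDFReal, NNReal.coe_one, mul_one, sub_zero]
  rw [mul_assoc, ← Real.exp_add]
  ring_nf

theorem integral_exp_sq_div_four_gaussianReal :
    ∫ x, Real.exp (x ^ 2 / 4) ∂(gaussianReal 0 1) = √2 := by
  rw [integral_gaussianReal_eq_integral_smul one_ne_zero]
  simp only [smul_eq_mul, gaussianPDFReal_mul_exp_sq_div_four]
  rw [integral_const_mul, integral_gaussian, ← Real.sqrt_inv, ← Real.sqrt_mul (by positivity)]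
  congr 1
  field_simp
  norm_num

theorem integrable_exp_sq_div_four_gaussianReal :
    Integrable (fun x => Real.exp (x ^ 2 / 4)) (gaussianReal 0 1) := by
  by_contra h
  have := integral_exp_sq_div_four_gaussianReal
  -- The integral of a non-integrable function is `0` by convention, which contradicts the value
  -- `√2`.
  rw [integral_undef h] at this
  exact (Real.sqrt_ne_zero'.2 two_pos) this.symm

/-- The moment generating function of a Rademacher sum. -/
theorem sum_signs_exp {d : ℕ} (a : Fin d → ℝ) :
    ∑ e : Fin d → ℤˣ, Real.exp (∑ j, ((e j : ℤ) : ℝ) * a j) = 2 ^ d * ∏ j, Real.cosh (a j) := by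
  simp only [Real.exp_sum]
  rw [← Fintype.prod_sum (fun j (u : ℤˣ) => Real.exp (((u : ℤ) : ℝ) * a j))]
  simp only [UnitsInt.univ]
  rw [show (2 : ℝ) ^ d = ∏ _j : Fin d, (2 : ℝ) by simp, ← Finset.prod_mul_distrib]
  refine Finset.prod_congr rfl fun j _ => ?_
  rw [Finset.sum_pair (by decide), Real.cosh_eq]
  simp
  ring

/-- Exponential square integrability of a Rademacher sum, by Gaussian linearization. -/
theorem sum_signs_exp_sq_le {d : ℕ} (a : Fin d → ℝ) (ha : ∑ j, a j ^ 2 ≤ 1) :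
    ∑ e : Fin d → ℤˣ, Real.exp ((∑ j, ((e j : ℤ) : ℝ) * a j) ^ 2 / 4) ≤ 2 ^ d * √2 := by
  -- A Gaussian average turns the square into a linear exponent, where the independent signs factor.
  have hlin (X : ℝ) : Real.exp (X ^ 2 / 4) = ∫ g, Real.exp (X / √2 * g) ∂(gaussianReal 0 1) := by
    have h := congrFun (mgf_id_gaussianReal (μ := 0) (v := 1)) (X / √2)
    simp only [mgf, id] at h
    rw [h, div_pow, Real.sq_sqrt zero_le_two]
    congr 1
    push_cast
    ring
  have hInt (X : ℝ) : Integrable (fun g => Real.exp (X / √2 * g)) (gaussianReal 0 1) :=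
    integrable_exp_mul_gaussianReal _
  have hrhs : 2 ^ d * √2 = ∫ g, 2 ^ d * Real.exp (g ^ 2 / 4) ∂(gaussianReal 0 1) := by
    rw [integral_const_mul, integral_exp_sq_div_four_gaussianReal]
  simp only [hlin]
  rw [← integral_finsetSum _ fun e _ => hInt _, hrhs]
  refine integral_mono (integrable_finsetSum _ fun e _ => hInt _)
    (integrable_exp_sq_div_four_gaussianReal.const_mul _) fun g => ?_
  calc _ = ∑ e : Fin d → ℤˣ, Real.exp (∑ j, ((e j : ℤ) : ℝ) * (a j * g / √2)) := by
        refine Finset.sum_congr rfl fun e _ => ?_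
        congr 1
        rw [Finset.sum_div, Finset.sum_mul]
        refine Finset.sum_congr rfl fun j _ => by ring
    _ = 2 ^ d * ∏ j, Real.cosh (a j * g / √2) := sum_signs_exp _
    _ ≤ 2 ^ d * ∏ j, Real.exp ((a j * g / √2) ^ 2 / 2) := by
        gcongr with j
        exact Real.cosh_le_exp_half_sq _
    _ = 2 ^ d * Real.exp ((∑ j, a j ^ 2) * (g ^ 2 / 4)) := by
        rw [← Real.exp_sum, Finset.sum_mul]
        congr 2
        refine Finset.sum_congr rfl fun j _ => ?_
        rw [div_pow, Real.sq_sqrt zero_le_two]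
        ring
    _ ≤ 2 ^ d * Real.exp (g ^ 2 / 4) := by
        gcongr
        exact mul_le_of_le_one_left (by positivity) ha

/-- The real and imaginary parts are real sign sums with square-summed coefficients at most `1`. The
inequality `ab ≤ (a² + b²) / 2` separates them, at the price of `1/8` in place of `1/4`. -/
theorem sum_signs_exp_norm_sq_le {d : ℕ} (v : EuclideanSpace ℂ (Fin d)) (hv : ‖v‖ = 1) :
    ∑ e : Fin d → ℤˣ, Real.exp (‖∑ j, ((e j : ℤ) : ℂ) * v j‖ ^ 2 / 8) ≤ 2 ^ d * 2 := by
  have hnorm : ∑ j, (v j).re ^ 2 + ∑ j, (v j).im ^ 2 = 1 := by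
    rw [← Finset.sum_add_distrib, ← one_pow 2, ← hv, EuclideanSpace.norm_sq_eq]
    refine Finset.sum_congr rfl fun j _ => ?_
    rw [Complex.sq_norm, Complex.normSq_apply]
    ring
  have hre := sum_signs_exp_sq_le (fun j => (v j).re)
    (by linarith [Finset.sum_nonneg fun j (_ : j ∈ Finset.univ) => sq_nonneg (v j).im])
  have him := sum_signs_exp_sq_le (fun j => (v j).im)
    (by linarith [Finset.sum_nonneg fun j (_ : j ∈ Finset.univ) => sq_nonneg (v j).re])
  have hpt (e : Fin d → ℤˣ) : Real.exp (‖∑ j, ((e j : ℤ) : ℂ) * v j‖ ^ 2 / 8) ≤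
      (Real.exp ((∑ j, ((e j : ℤ) : ℝ) * (v j).re) ^ 2 / 4) +
        Real.exp ((∑ j, ((e j : ℤ) : ℝ) * (v j).im) ^ 2 / 4)) / 2 := by
    set x := ∑ j, ((e j : ℤ) : ℝ) * (v j).re with hx
    set y := ∑ j, ((e j : ℤ) : ℝ) * (v j).im with hy
    have hxy : ‖∑ j, ((e j : ℤ) : ℂ) * v j‖ ^ 2 = x ^ 2 + y ^ 2 := by
      rw [Complex.sq_norm, Complex.normSq_apply, Complex.re_sum, Complex.im_sum]
      simp [hx, hy, sq]
    have h1 : Real.exp (‖∑ j, ((e j : ℤ) : ℂ) * v j‖ ^ 2 / 8) =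
        Real.exp (x ^ 2 / 8) * Real.exp (y ^ 2 / 8) := by
      rw [hxy, ← Real.exp_add]; ring_nf
    have h2 (z : ℝ) : Real.exp (z ^ 2 / 4) = Real.exp (z ^ 2 / 8) ^ 2 := by
      rw [← Real.exp_nat_mul]; push_cast; ring_nf
    rw [h1, h2, h2]
    nlinarith [sq_nonneg (Real.exp (x ^ 2 / 8) - Real.exp (y ^ 2 / 8))]
  have hsqrt : √2 ≤ 2 := by rw [Real.sqrt_le_left (by norm_num)]; norm_num
  calc _ ≤ _ := Finset.sum_le_sum fun e _ => hpt e
    _ = (∑ e : Fin d → ℤˣ, Real.exp ((∑ j, ((e j : ℤ) : ℝ) * (v j).re) ^ 2 / 4) +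
        ∑ e : Fin d → ℤˣ, Real.exp ((∑ j, ((e j : ℤ) : ℝ) * (v j).im) ^ 2 / 4)) / 2 := by
        rw [← Finset.sum_add_distrib, Finset.sum_div]
    _ ≤ 2 ^ d * √2 := by linarith
    _ ≤ _ := by gcongr

/-! ### Transition probabilities and the unitary action on the sphere. -/

/-- The transition probability `|⟪ψ, V φ⟫|²`. -/
noncomputable def transitionProb {d : ℕ} (V : Matrix.unitaryGroup (Fin d) ℂ)
    (φ ψ : EuclideanSpace ℂ (Fin d)) : ℝ :=
  ‖inner ℂ ψ (Matrix.toEuclideanCLM (𝕜 := ℂ) (V : Matrix (Fin d) (Fin d) ℂ) φ)‖ ^ 2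

section Unitary

variable {d : ℕ}

theorem adjoint_toEuclideanCLM (A : Matrix (Fin d) (Fin d) ℂ) :
    ContinuousLinearMap.adjoint (Matrix.toEuclideanCLM (𝕜 := ℂ) A) =
      Matrix.toEuclideanCLM (𝕜 := ℂ) A.conjTranspose := by
  rw [← ContinuousLinearMap.star_eq_adjoint, ← map_star, Matrix.star_eq_conjTranspose]

theorem inner_toEuclideanCLM_unitary (V : Matrix.unitaryGroup (Fin d) ℂ)
    (x y : EuclideanSpace ℂ (Fin d)) :
    inner ℂ (Matrix.toEuclideanCLM (𝕜 := ℂ) (V : Matrix (Fin d) (Fin d) ℂ) x)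
      (Matrix.toEuclideanCLM (𝕜 := ℂ) (V : Matrix (Fin d) (Fin d) ℂ) y) = inner ℂ x y := by
  rw [← ContinuousLinearMap.adjoint_inner_right, adjoint_toEuclideanCLM,
    ← mul_apply_eq_comp, ← map_mul, ← Matrix.star_eq_conjTranspose,
    Matrix.UnitaryGroup.star_mul_self, map_one, one_apply_eq_self]

theorem norm_toEuclideanCLM_unitary (V : Matrix.unitaryGroup (Fin d) ℂ)
    (x : EuclideanSpace ℂ (Fin d)) :
    ‖Matrix.toEuclideanCLM (𝕜 := ℂ) (V : Matrix (Fin d) (Fin d) ℂ) x‖ = ‖x‖ := by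
  rw [@norm_eq_sqrt_re_inner ℂ, inner_toEuclideanCLM_unitary, ← @norm_eq_sqrt_re_inner ℂ]

/-- The unitary group acts transitively on the unit sphere. -/
theorem exists_unitary_map_eq {x y : EuclideanSpace ℂ (Fin d)} (hx : ‖x‖ = 1) (hy : ‖y‖ = 1) :
    ∃ W : Matrix.unitaryGroup (Fin d) ℂ,
      Matrix.toEuclideanCLM (𝕜 := ℂ) (W : Matrix (Fin d) (Fin d) ℂ) x = y := by
  let e := LinearIsometryEquiv.toSpanUnitSingleton (𝕜 := ℂ) x hx
  -- The isometry `x ↦ y` between lines extends to the whole space; in finite dimension `f† f = 1`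
  -- already makes it unitary.
  let L : (Submodule.span ℂ {x}) →ₗᵢ[ℂ] EuclideanSpace ℂ (Fin d) :=
    (LinearIsometry.toSpanSingleton ℂ _ hy).comp e.symm.toLinearIsometry
  let f : EuclideanSpace ℂ (Fin d) →L[ℂ] EuclideanSpace ℂ (Fin d) :=
    L.extend.toContinuousLinearMap
  have hf : f x = y := by
    have h1 : e 1 = ⟨x, Submodule.mem_span_singleton_self x⟩ := by
      ext1; simp [e]
    have h2 := L.extend_apply ⟨x, Submodule.mem_span_singleton_self x⟩
    rw [← h1] at h2
    have h3 : (e 1 : EuclideanSpace ℂ (Fin d)) = x := by rw [h1]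
    rw [h3] at h2
    change L.extend x = y
    rw [h2]
    simp [L]
  have hadj : star f * f = 1 := (ContinuousLinearMap.norm_map_iff_adjoint_comp_self f).1
    fun z => L.extend.norm_map z
  obtain ⟨A, hA⟩ := EquivLike.surjective (Matrix.toEuclideanCLM (𝕜 := ℂ) (n := Fin d)) f
  refine ⟨⟨A, ?_⟩, by rw [hA, hf]⟩
  rw [Matrix.mem_unitaryGroup_iff']
  apply EquivLike.injective (Matrix.toEuclideanCLM (𝕜 := ℂ) (n := Fin d))
  rw [map_mul, map_star, hA, hadj, map_one]

theorem transitionProb_nonneg (V : Matrix.unitaryGroup (Fin d) ℂ)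
    (φ ψ : EuclideanSpace ℂ (Fin d)) : 0 ≤ transitionProb V φ ψ := sq_nonneg _

theorem transitionProb_le_one (V : Matrix.unitaryGroup (Fin d) ℂ)
    {φ ψ : EuclideanSpace ℂ (Fin d)} (hφ : ‖φ‖ = 1) (hψ : ‖ψ‖ = 1) :
    transitionProb V φ ψ ≤ 1 := by
  have h := norm_inner_le_norm (𝕜 := ℂ) ψ
    (Matrix.toEuclideanCLM (𝕜 := ℂ) (V : Matrix (Fin d) (Fin d) ℂ) φ)
  rw [norm_toEuclideanCLM_unitary, hφ, hψ, one_mul] at h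
  exact pow_le_one₀ (norm_nonneg _) h

theorem continuous_toEuclideanCLM_apply (x : EuclideanSpace ℂ (Fin d)) :
    Continuous fun A : Matrix (Fin d) (Fin d) ℂ => Matrix.toEuclideanCLM (𝕜 := ℂ) A x := by
  have : (fun A : Matrix (Fin d) (Fin d) ℂ => Matrix.toEuclideanCLM (𝕜 := ℂ) A x) =
      fun A => WithLp.toLp 2 (A.mulVec x.ofLp) := by
    funext A
    rw [← Matrix.ofLp_toEuclideanCLM]
  rw [this]
  exact (PiLp.continuous_toLp 2 _).comp (continuous_id.matrix_mulVec continuous_const)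

theorem continuous_transitionProb (φ ψ : EuclideanSpace ℂ (Fin d)) :
    Continuous fun V : Matrix.unitaryGroup (Fin d) ℂ => transitionProb V φ ψ :=
  ((continuous_const.inner
    ((continuous_toEuclideanCLM_apply φ).comp continuous_subtype_val)).norm).pow 2

theorem sum_transitionProb_basis (V : Matrix.unitaryGroup (Fin d) ℂ)
    (φ : EuclideanSpace ℂ (Fin d)) :
    ∑ j, transitionProb V φ (EuclideanSpace.basisFun (Fin d) ℂ j) = ‖φ‖ ^ 2 := by
  simp only [transitionProb]
  rw [OrthonormalBasis.sum_sq_norm_inner_right, norm_toEuclideanCLM_unitary]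

end Unitary

/-! ### Moments under Haar measure. -/

section Haar

variable {d : ℕ} (μ : Measure (Matrix.unitaryGroup (Fin d) ℂ)) {φ : EuclideanSpace ℂ (Fin d)}

/-- Under Haar measure, the law of the transition probability does not depend on the target. -/
theorem integral_transitionProb_eq [μ.IsHaarMeasure] (F : ℝ → ℝ) (φ : EuclideanSpace ℂ (Fin d))
    {ψ ψ' : EuclideanSpace ℂ (Fin d)} (hψ : ‖ψ‖ = 1) (hψ' : ‖ψ'‖ = 1) :
    ∫ V, F (transitionProb V φ ψ) ∂μ = ∫ V, F (transitionProb V φ ψ') ∂μ := by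
  obtain ⟨W, hW⟩ := exists_unitary_map_eq hψ hψ'
  -- Left translation by `W` moves the target: `⟪W ψ, W V φ⟫ = ⟪ψ, V φ⟫`.
  rw [← integral_mul_left_eq_self (μ := μ) (fun V => F (transitionProb V φ ψ')) W]
  congr 1
  funext V
  simp only [transitionProb]
  rw [← hW, Submonoid.coe_mul, map_mul, mul_apply_eq_comp,
    inner_toEuclideanCLM_unitary]

variable [IsProbabilityMeasure μ]

theorem integrable_comp_transitionProb {F : ℝ → ℝ} (hF : Continuous F)
    {ψ : EuclideanSpace ℂ (Fin d)} (hφ : ‖φ‖ = 1) (hψ : ‖ψ‖ = 1) : Integrable (fun V => F (transitionProb V φ ψ)) μ := by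
  obtain ⟨R, hR⟩ := (isCompact_Icc (a := (0 : ℝ)) (b := 1)).exists_bound_of_continuousOn
    hF.continuousOn
  exact integrable_of_abs_le (hF.comp (continuous_transitionProb φ ψ)).measurable fun V =>
    hR _ ⟨transitionProb_nonneg V φ ψ, transitionProb_le_one V hφ hψ⟩

/-- All basis vectors give the same mean as `ψ`, and by Parseval their transition probabilities sum
to `1`. -/
theorem integral_transitionProb [μ.IsHaarMeasure] (hφ : ‖φ‖ = 1) {ψ : EuclideanSpace ℂ (Fin d)} (hψ : ‖ψ‖ = 1) :
    d * ∫ V, transitionProb V φ ψ ∂μ = 1 := by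
  have hb (j : Fin d) : ‖EuclideanSpace.basisFun (Fin d) ℂ j‖ = 1 :=
    (EuclideanSpace.basisFun (Fin d) ℂ).norm_eq_one j
  calc d * ∫ V, transitionProb V φ ψ ∂μ
      = ∑ j, ∫ V, transitionProb V φ (EuclideanSpace.basisFun (Fin d) ℂ j) ∂μ := by
        have h (j : Fin d) := integral_transitionProb_eq μ id φ (hb j) hψ
        simp only [id] at h
        simp only [h, Finset.sum_const, Finset.card_univ, Fintype.card_fin, nsmul_eq_mul]
    _ = ∫ V, ∑ j, transitionProb V φ (EuclideanSpace.basisFun (Fin d) ℂ j) ∂μ :=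
        (integral_finsetSum _ fun j _ =>
          integrable_comp_transitionProb μ continuous_id hφ (hb j)).symm
    _ = 1 := by simp only [sum_transitionProb_basis, hφ, one_pow, integral_const, probReal_univ,
          smul_eq_mul, mul_one]

/-- Averaging the target over the `2 ^ d` flat unit vectors `e / √d` leaves the integral unchanged,
while for each fixed `V` it turns `d * transitionProb` into the squared modulus of a sign sum with
coefficient vector `V φ`. -/
theorem integral_exp_transitionProb_le [μ.IsHaarMeasure] (hd : 1 ≤ d) (hφ : ‖φ‖ = 1)
    {ψ : EuclideanSpace ℂ (Fin d)} (hψ : ‖ψ‖ = 1) :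
    ∫ V, Real.exp (d * transitionProb V φ ψ / 8) ∂μ ≤ 2 := by
  have hd0 : (0 : ℝ) < d := by exact_mod_cast hd
  let η (e : Fin d → ℤˣ) : EuclideanSpace ℂ (Fin d) :=
    WithLp.toLp 2 fun j => ((√d)⁻¹ : ℂ) * ((e j : ℤ) : ℂ)
  have hsign (u : ℤˣ) : ‖((u : ℤ) : ℂ)‖ = 1 := by
    rcases Int.units_eq_one_or u with rfl | rfl <;> simp
  have hη (e) : ‖η e‖ = 1 := by
    rw [← sq_eq_sq₀ (norm_nonneg _) zero_le_one, EuclideanSpace.norm_sq_eq]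
    simp only [η, norm_mul, hsign, mul_one, Finset.sum_const, Finset.card_univ, Fintype.card_fin,
      nsmul_eq_mul, norm_inv, Complex.norm_real, Real.norm_eq_abs, inv_pow, sq_abs, one_pow]
    rw [Real.sq_sqrt hd0.le, mul_inv_cancel₀ hd0.ne']
  have hηprob (e) (V : Matrix.unitaryGroup (Fin d) ℂ) : d * transitionProb V φ (η e) =
      ‖∑ j, ((e j : ℤ) : ℂ) *
        (Matrix.toEuclideanCLM (𝕜 := ℂ) (V : Matrix (Fin d) (Fin d) ℂ) φ) j‖ ^ 2 := by
    have : inner ℂ (η e) (Matrix.toEuclideanCLM (𝕜 := ℂ) (V : Matrix (Fin d) (Fin d) ℂ) φ) =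
        ((√d)⁻¹ : ℂ) * ∑ j, ((e j : ℤ) : ℂ) *
          (Matrix.toEuclideanCLM (𝕜 := ℂ) (V : Matrix (Fin d) (Fin d) ℂ) φ) j := by
      rw [PiLp.inner_apply, Finset.mul_sum]
      refine Finset.sum_congr rfl fun j _ => ?_
      simp [η, RCLike.inner_apply]
      ring
    rw [transitionProb, this, norm_mul, mul_pow, norm_inv, Complex.norm_real, Real.norm_eq_abs,
      inv_pow, sq_abs, Real.sq_sqrt hd0.le, mul_inv_cancel_left₀ hd0.ne']
  have hF : Continuous fun p : ℝ => Real.exp (d * p / 8) := by fun_prop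
  have hcard : ∑ _e : Fin d → ℤˣ, (1 : ℝ) = 2 ^ d := by simp
  have havg : 2 ^ d * ∫ V, Real.exp (d * transitionProb V φ ψ / 8) ∂μ ≤ 2 ^ d * 2 :=
    calc _ = ∑ e : Fin d → ℤˣ, ∫ V, Real.exp (d * transitionProb V φ (η e) / 8) ∂μ := by
          rw [Finset.sum_congr rfl fun e _ => integral_transitionProb_eq μ
            (fun p => Real.exp (d * p / 8)) φ (hη e) hψ, ← hcard, Finset.sum_mul]
          simp
      _ = ∫ V, ∑ e : Fin d → ℤˣ, Real.exp (d * transitionProb V φ (η e) / 8) ∂μ :=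
          (integral_finsetSum _ fun e _ => integrable_comp_transitionProb μ hF hφ (hη e)).symm
      _ ≤ ∫ _V, 2 ^ d * 2 ∂μ := by
          refine integral_mono (integrable_finsetSum _ fun e _ =>
            integrable_comp_transitionProb μ hF hφ (hη e)) (integrable_const _) fun V => ?_
          simp only [hηprob]
          exact sum_signs_exp_norm_sq_le _ (by rw [norm_toEuclideanCLM_unitary, hφ])
      _ = _ := by simp
  exact le_of_mul_le_mul_left havg (by positivity)

end Haar

/-- Concentration of the averaged transition probability between two fixed unit vectors. -/
theorem measureReal_abs_average_transitionProb_ge_le {d N : ℕ} (hd : 1 ≤ d) {Ω : Type*}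
    [MeasurableSpace Ω] {P : Measure Ω} [IsProbabilityMeasure P]
    {U : Fin N → Ω → Matrix.unitaryGroup (Fin d) ℂ} (hU : ∀ i, IsHaarDistributed (U i) P)
    (hind : iIndepFun U P) {φ ψ : EuclideanSpace ℂ (Fin d)} (hφ : ‖φ‖ = 1) (hψ : ‖ψ‖ = 1)
    {t : ℝ} (ht : 0 ≤ t) (ht1 : t ≤ 1) :
    P.real {ω | N * t ≤ |∑ i, (d * transitionProb (U i ω) φ ψ - 1)|} ≤
      2 * Real.exp (-(N * t ^ 2 / 8192)) := by
  have hd0 : (1 : ℝ) ≤ d := by exact_mod_cast hd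
  have hmeas : Measurable fun V : Matrix.unitaryGroup (Fin d) ℂ => d * transitionProb V φ ψ - 1 :=
    ((continuous_const.mul (continuous_transitionProb φ ψ)).sub continuous_const).measurable
  have h := measureReal_abs_sum_ge_le (P := P)
    -- The moment bound `M = 4` comes from `exp (1/8) * 2 ≤ 4`; then `4 * (8 * M / s ^ 2) = 8192`.
    (Z := fun i ω => d * transitionProb (U i ω) φ ψ - 1) (R := d) (s := 1 / 8) (M := 4) (t := t)
    (fun i => hmeas.comp (hU i).measurable) ?_ (hind.comp _ fun _ => hmeas) ?_ (by norm_num)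
    (by norm_num) (by norm_num) ?_ ht ht1
  · convert h using 5
    norm_num
  · intro i ω
    have h0 := transitionProb_nonneg (U i ω) φ ψ
    have h1 := transitionProb_le_one (U i ω) hφ hψ
    rw [abs_le]
    constructor <;> nlinarith
  · intro i
    have := (hU i).isHaar
    have : IsProbabilityMeasure (P.map (U i)) :=
      Measure.isProbabilityMeasure_map (hU i).measurable.aemeasurable
    have hInt : Integrable (fun V => transitionProb V φ ψ) (P.map (U i)) :=
      integrable_comp_transitionProb _ continuous_id hφ hψ
    rw [← integral_map (φ := U i) (hU i).measurable.aemeasurable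
      (f := fun V => d * transitionProb V φ ψ - 1) hmeas.aestronglyMeasurable,
      integral_sub (hInt.const_mul _) (integrable_const _), integral_const_mul,
      integral_transitionProb _ hφ hψ]
    simp
  · intro i
    have := (hU i).isHaar
    have : IsProbabilityMeasure (P.map (U i)) :=
      Measure.isProbabilityMeasure_map (hU i).measurable.aemeasurable
    have hF : Continuous fun p : ℝ => Real.exp (1 / 8 * |d * p - 1|) := by fun_prop
    have hG : Continuous fun p : ℝ => Real.exp (d * p / 8) := by fun_prop
    rw [← integral_map (φ := U i) (hU i).measurable.aemeasurable
      (f := fun V => Real.exp (1 / 8 * |d * transitionProb V φ ψ - 1|))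
      (integrable_comp_transitionProb _ hF hφ hψ).aestronglyMeasurable]
    have hexp : Real.exp (1 / 8) ≤ 2 := by
      have := Real.exp_one_lt_d9
      have h8 : Real.exp (1 / 8) ^ 8 = Real.exp 1 := by rw [← Real.exp_nat_mul]; norm_num
      by_contra! hlt
      have : (2 : ℝ) ^ 8 ≤ Real.exp (1 / 8) ^ 8 := by gcongr
      linarith
    calc _ ≤ ∫ V, Real.exp (1 / 8) * Real.exp (d * transitionProb V φ ψ / 8) ∂(P.map (U i)) := by
          refine integral_mono (integrable_comp_transitionProb _ hF hφ hψ)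
            ((integrable_comp_transitionProb _ hG hφ hψ).const_mul _) fun V => ?_
          rw [← Real.exp_add, Real.exp_le_exp]
          have h0 : 0 ≤ d * transitionProb V φ ψ :=
            mul_nonneg (by linarith) (transitionProb_nonneg V φ ψ)
          have : |d * transitionProb V φ ψ - 1| ≤ d * transitionProb V φ ψ + 1 := by
            rw [abs_le]; constructor <;> linarith
          linarith
      _ ≤ Real.exp (1 / 8) * 2 := by
          rw [integral_const_mul]
          gcongr
          exact integral_exp_transitionProb_le _ hd hφ hψ
      _ ≤ 4 := by linarith

/-! ### The channel and its deviation form. -/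

section Channel

variable {d N : ℕ} (U : Fin N → Matrix.unitaryGroup (Fin d) ℂ)

theorem averageConj_apply (ρ : Matrix (Fin d) (Fin d) ℂ) :
    averageConj U ρ = (N : ℂ)⁻¹ • ∑ i, (U i : Matrix (Fin d) (Fin d) ℂ) * ρ *
      (U i : Matrix (Fin d) (Fin d) ℂ).conjTranspose := rfl

-- The amplified map is an average of conjugations by `Uᵢ ⊗ 1`, which makes complete positivity
-- evident.
open scoped Kronecker in
theorem amplify_averageConj (k : ℕ) (X : Matrix (Fin d × Fin k) (Fin d × Fin k) ℂ) :
    amplify (averageConj U) k X = (N : ℂ)⁻¹ • ∑ i,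
      ((U i : Matrix (Fin d) (Fin d) ℂ) ⊗ₖ (1 : Matrix (Fin k) (Fin k) ℂ)) * X *
      ((U i : Matrix (Fin d) (Fin d) ℂ) ⊗ₖ (1 : Matrix (Fin k) (Fin k) ℂ)).conjTranspose := by
  ext ⟨p, a⟩ ⟨q, b⟩
  simp [amplify, averageConj_apply, Matrix.sum_apply, Matrix.mul_apply, Fintype.sum_prod_type,
    Matrix.one_apply, apply_ite (starRingEnd ℂ)]

theorem isQuantumChannel_averageConj (hN : N ≠ 0) : IsQuantumChannel (averageConj U) where
  completelyPositive k X hX := by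
    rw [amplify_averageConj]
    refine Matrix.PosSemidef.smul (Matrix.posSemidef_sum _ fun i _ =>
      hX.mul_mul_conjTranspose_same _) ?_
    rw [inv_nonneg]
    exact Nat.cast_nonneg N
  trace_preserving X := by
    have h (i : Fin N) : ((U i : Matrix (Fin d) (Fin d) ℂ) * X *
        (U i : Matrix (Fin d) (Fin d) ℂ).conjTranspose).trace = X.trace := by
      rw [Matrix.trace_mul_comm, ← mul_assoc, ← Matrix.star_eq_conjTranspose,
        Matrix.UnitaryGroup.star_mul_self, one_mul]
    rw [averageConj_apply, Matrix.trace_smul, Matrix.trace_sum]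
    simp [h, hN]

/-- The quadratic form `⟪ψ, (Φ(φφ†) - ‖φ‖² Id / d) ψ⟫` of `Φ = averageConj U`. -/
noncomputable def deviation (φ ψ : EuclideanSpace ℂ (Fin d)) : ℝ :=
  (N : ℝ)⁻¹ * ∑ i, transitionProb (U i) φ ψ - (d : ℝ)⁻¹ * ‖φ‖ ^ 2 * ‖ψ‖ ^ 2

/-- With one argument fixed, the deviation is a frame form in the other, with frame `Uᵢ φ` here and
`Uᵢ† ψ` in `deviation_eq_frame_left`, so `abs_frame_form_sub_le` applies to each. -/
theorem deviation_eq_frame_right (φ ψ : EuclideanSpace ℂ (Fin d)) :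
    deviation U φ ψ = (N : ℝ)⁻¹ * ∑ i, ‖inner ℂ
      (Matrix.toEuclideanCLM (𝕜 := ℂ) (U i : Matrix (Fin d) (Fin d) ℂ) φ) ψ‖ ^ 2 -
      (d : ℝ)⁻¹ * ‖φ‖ ^ 2 * ‖ψ‖ ^ 2 := by
  simp only [deviation, transitionProb, norm_inner_symm ψ]

theorem deviation_eq_frame_left (φ ψ : EuclideanSpace ℂ (Fin d)) :
    deviation U φ ψ = (N : ℝ)⁻¹ * ∑ i, ‖inner ℂ (ContinuousLinearMap.adjoint
      (Matrix.toEuclideanCLM (𝕜 := ℂ) (U i : Matrix (Fin d) (Fin d) ℂ)) ψ) φ‖ ^ 2 -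
      (d : ℝ)⁻¹ * ‖ψ‖ ^ 2 * ‖φ‖ ^ 2 := by
  simp only [deviation, transitionProb, ContinuousLinearMap.adjoint_inner_left]
  ring

theorem abs_deviation_le {φ ψ : EuclideanSpace ℂ (Fin d)} (hφ : ‖φ‖ = 1) (hψ : ‖ψ‖ = 1) :
    |deviation U φ ψ| ≤ (N : ℝ)⁻¹ * N + (d : ℝ)⁻¹ := by
  have h0 : 0 ≤ ∑ i, transitionProb (U i) φ ψ :=
    Finset.sum_nonneg fun i _ => transitionProb_nonneg _ _ _
  have h1 : ∑ i, transitionProb (U i) φ ψ ≤ N :=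
    (Finset.sum_le_sum fun i _ => transitionProb_le_one _ hφ hψ).trans (by simp)
  have h2 : (N : ℝ)⁻¹ * ∑ i, transitionProb (U i) φ ψ ≤ (N : ℝ)⁻¹ * N := by gcongr
  have h3 : 0 ≤ (N : ℝ)⁻¹ * ∑ i, transitionProb (U i) φ ψ := by positivity
  have h4 : 0 ≤ (d : ℝ)⁻¹ := by positivity
  rw [deviation, hφ, hψ, abs_le]
  constructor <;> linarith

theorem abs_deviation_le_of_net {A : ℝ} (s : Finset (EuclideanSpace ℂ (Fin d)))
    (hs : ∀ c ∈ s, ‖c‖ = 1)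
    (hnet : ∀ x : EuclideanSpace ℂ (Fin d), ‖x‖ = 1 → ∃ y ∈ s, ‖x - y‖ ≤ 1 / 8)
    (hA : ∀ x ∈ s, ∀ y ∈ s, |deviation U x y| ≤ A) {x y : EuclideanSpace ℂ (Fin d)}
    (hx : ‖x‖ = 1) (hy : ‖y‖ = 1) : |deviation U x y| ≤ 2 * A := by
  refine abs_le_two_mul_of_net (deviation U) (fun _ _ hx hy => abs_deviation_le U hx hy) ?_ ?_
    s hs hnet hA hx hy
  · intro B hB h x x' y hx hx' hy
    rw [deviation_eq_frame_left, deviation_eq_frame_left]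
    refine abs_frame_form_sub_le _ _ _ hB (fun z hz => ?_) hx hx'
    rw [← deviation_eq_frame_left]
    exact h z y hz hy
  · intro B hB h x y y' hx hy hy'
    rw [deviation_eq_frame_right, deviation_eq_frame_right]
    refine abs_frame_form_sub_le _ _ _ hB (fun z hz => ?_) hy hy'
    rw [← deviation_eq_frame_right]
    exact h x z hx hz

theorem deviation_smul_left (c : ℂ) (φ ψ : EuclideanSpace ℂ (Fin d)) :
    deviation U (c • φ) ψ = ‖c‖ ^ 2 * deviation U φ ψ := by
  simp only [deviation, transitionProb, map_smul, inner_smul_right, norm_mul, norm_smul, mul_pow,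
    ← Finset.mul_sum]
  ring

theorem abs_deviation_le_mul_norm_sq {B : ℝ}
    (h : ∀ φ ψ, ‖φ‖ = 1 → ‖ψ‖ = 1 → |deviation U φ ψ| ≤ B)
    (φ : EuclideanSpace ℂ (Fin d)) {ψ : EuclideanSpace ℂ (Fin d)} (hψ : ‖ψ‖ = 1) :
    |deviation U φ ψ| ≤ ‖φ‖ ^ 2 * B := by
  rcases eq_or_ne φ 0 with rfl | hφ
  · simp [deviation, transitionProb]
  have hn : ‖(‖φ‖⁻¹ : ℂ) • φ‖ = 1 := norm_smul_inv_norm hφ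
  have hφ' : φ = (‖φ‖ : ℂ) • ((‖φ‖⁻¹ : ℂ) • φ) := by
    rw [smul_smul, mul_inv_cancel₀ (by simpa using hφ), one_smul]
  have heq : deviation U φ ψ = ‖φ‖ ^ 2 * deviation U ((‖φ‖⁻¹ : ℂ) • φ) ψ := by
    conv_lhs => rw [hφ', deviation_smul_left]
    simp
  rw [heq, abs_mul, abs_of_nonneg (sq_nonneg ‖φ‖)]
  gcongr
  exact h _ _ hn hψ

theorem toEuclideanCLM_vecMulVec_apply (v : Fin d → ℂ) (x : EuclideanSpace ℂ (Fin d)) :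
    Matrix.toEuclideanCLM (𝕜 := ℂ) (Matrix.vecMulVec v (star v)) x =
      inner ℂ (WithLp.toLp 2 v) x • WithLp.toLp 2 v := by
  ext j
  rw [Matrix.ofLp_toEuclideanCLM, Matrix.vecMulVec_mulVec]
  simp [PiLp.inner_apply, dotProduct, mul_comm]

theorem inner_averageConj_vecMulVec (v : Fin d → ℂ) (ψ : EuclideanSpace ℂ (Fin d)) :
    inner ℂ (Matrix.toEuclideanCLM (𝕜 := ℂ)
      (averageConj U (Matrix.vecMulVec v (star v))) ψ) ψ =
      (((N : ℝ)⁻¹ * ∑ i, transitionProb (U i) (WithLp.toLp 2 v) ψ : ℝ) : ℂ) := by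
  have h (i : Fin N) : inner ℂ (Matrix.toEuclideanCLM (𝕜 := ℂ)
      ((U i : Matrix (Fin d) (Fin d) ℂ) * Matrix.vecMulVec v (star v) *
        (U i : Matrix (Fin d) (Fin d) ℂ).conjTranspose) ψ) ψ =
      ((transitionProb (U i) (WithLp.toLp 2 v) ψ : ℝ) : ℂ) := by
    rw [map_mul, map_mul, mul_apply_eq_comp, mul_apply_eq_comp, toEuclideanCLM_vecMulVec_apply,
      ← adjoint_toEuclideanCLM, ContinuousLinearMap.adjoint_inner_right, map_smul,
      inner_smul_left, transitionProb, norm_inner_symm, RCLike.conj_mul]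
    push_cast
    rfl
  rw [averageConj_apply, map_smul, map_sum, smul_apply,
    sum_apply, inner_smul_left, sum_inner]
  simp only [h]
  push_cast
  simp

-- Writing `ρ = ∑ vₖ vₖ†` with `∑ ‖vₖ‖² = 1`, the form of the difference at a unit vector is the sum
-- of the deviations at `vₖ`, each at most `‖vₖ‖² B`.
open scoped Matrix.Norms.L2Operator in
theorem norm_averageConj_sub_maxMixed_le {B : ℝ} (hB : 0 ≤ B)
    (h : ∀ φ ψ, ‖φ‖ = 1 → ‖ψ‖ = 1 → |deviation U φ ψ| ≤ B)
    {ρ : Matrix (Fin d) (Fin d) ℂ} (hρ : IsState ρ) : ‖averageConj U ρ - maxMixed d‖ ≤ B := by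
  obtain ⟨m, v, hv⟩ := Matrix.posSemidef_iff_eq_sum_vecMulVec.1 hρ.posSemidef
  have htrace : ∑ k, ‖(WithLp.toLp 2 (v k) : EuclideanSpace ℂ (Fin d))‖ ^ 2 = 1 := by
    have h1 := hρ.trace_eq_one
    rw [hv, Matrix.trace_sum] at h1
    have h2 (k) : (Matrix.vecMulVec (v k) (star (v k))).trace =
        ((‖(WithLp.toLp 2 (v k) : EuclideanSpace ℂ (Fin d))‖ ^ 2 : ℝ) : ℂ) := by
      rw [EuclideanSpace.norm_sq_eq, Matrix.trace, Complex.ofReal_sum]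
      refine Finset.sum_congr rfl fun j _ => ?_
      simp [Matrix.vecMulVec_apply, Complex.mul_conj, Complex.normSq_eq_norm_sq]
    simp only [h2] at h1
    exact_mod_cast h1
  have hherm : (averageConj U ρ - maxMixed d).IsHermitian := by
    refine Matrix.IsHermitian.sub ?_ ?_
    · rw [Matrix.IsHermitian, averageConj_apply, Matrix.conjTranspose_smul,
        Matrix.conjTranspose_sum]
      simp [Matrix.conjTranspose_mul, hρ.posSemidef.isHermitian.eq, mul_assoc]
    · simp [Matrix.IsHermitian, maxMixed, Matrix.conjTranspose_smul]
  rw [← Matrix.l2_opNorm_toEuclideanCLM]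
  refine norm_le_of_abs_re_inner_le ?_ hB fun ψ hψ => ?_
  · rw [← ContinuousLinearMap.isSelfAdjoint_iff_isSymmetric,
      ContinuousLinearMap.isSelfAdjoint_iff', adjoint_toEuclideanCLM, hherm.eq]
  have hform : RCLike.re (inner ℂ
      (Matrix.toEuclideanCLM (𝕜 := ℂ) (averageConj U ρ - maxMixed d) ψ) ψ) =
      ∑ k, deviation U (WithLp.toLp 2 (v k)) ψ := by
    have hmix : inner ℂ (Matrix.toEuclideanCLM (𝕜 := ℂ) (maxMixed d) ψ) ψ =
        (((d : ℝ)⁻¹ : ℝ) : ℂ) := by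
      rw [maxMixed, map_smul, map_one, smul_apply, one_apply_eq_self,
        inner_smul_left, inner_self_eq_norm_sq_to_K, hψ]
      simp
    rw [map_sub, sub_apply, inner_sub_left, hmix]
    conv_lhs => rw [hv]
    rw [map_sum, map_sum, sum_apply, sum_inner]
    simp only [inner_averageConj_vecMulVec]
    rw [← Complex.ofReal_sum, ← Complex.ofReal_sub]
    simp only [deviation, hψ, one_pow, mul_one, Finset.sum_sub_distrib, ← Finset.mul_sum, htrace]
    exact Complex.ofReal_re _
  rw [hform]
  calc _ ≤ ∑ k, |deviation U (WithLp.toLp 2 (v k)) ψ| := Finset.abs_sum_le_sum_abs _ _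
    _ ≤ ∑ k, ‖(WithLp.toLp 2 (v k) : EuclideanSpace ℂ (Fin d))‖ ^ 2 * B :=
        Finset.sum_le_sum fun k _ => abs_deviation_le_mul_norm_sq U h _ hψ
    _ = B := by rw [← Finset.sum_mul, htrace, one_mul]

-- Closedness survives the uncountable intersection over states, where measurability alone need not.
open scoped Matrix.Norms.L2Operator in
theorem isClosed_setOf_isRandomizing (hN : N ≠ 0) (ε : ℝ) :
    IsClosed {V : Fin N → Matrix.unitaryGroup (Fin d) ℂ | IsRandomizing (averageConj V) ε} := by
  have heq : {V : Fin N → Matrix.unitaryGroup (Fin d) ℂ | IsRandomizing (averageConj V) ε} =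
      ⋂ (ρ : Matrix (Fin d) (Fin d) ℂ) (_ : IsState ρ),
        {V | ‖averageConj V ρ - maxMixed d‖ ≤ ε / d} := by
    ext V
    simp only [Set.mem_ofPred_eq, Set.mem_iInter]
    exact ⟨fun h => h.norm_sub_le, fun h => ⟨isQuantumChannel_averageConj V hN, h⟩⟩
  rw [heq]
  refine isClosed_iInter fun ρ => isClosed_iInter fun _ => isClosed_le ?_ continuous_const
  refine continuous_norm.comp (Continuous.sub ?_ continuous_const)
  simp only [averageConj_apply]
  have hval (i : Fin N) : Continuous fun V : Fin N → Matrix.unitaryGroup (Fin d) ℂ =>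
      (V i : Matrix (Fin d) (Fin d) ℂ) := continuous_subtype_val.comp (continuous_apply i)
  have hsum : Continuous fun V : Fin N → Matrix.unitaryGroup (Fin d) ℂ =>
      ∑ i, (V i : Matrix (Fin d) (Fin d) ℂ) * ρ * (V i : Matrix (Fin d) (Fin d) ℂ).conjTranspose :=
    continuous_finsetSum _ fun i _ =>
      ((hval i).matrix_mul continuous_const).matrix_mul (hval i).matrix_conjTranspose
  exact hsum.const_smul (N : ℂ)⁻¹

theorem measurableSet_isRandomizing (hN : N ≠ 0) (ε : ℝ) {Ω : Type*} [MeasurableSpace Ω]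
    {V : Fin N → Ω → Matrix.unitaryGroup (Fin d) ℂ} (hV : ∀ i, Measurable (V i)) :
    MeasurableSet {ω | IsRandomizing (averageConj fun i => V i ω) ε} := by
  -- Second countability makes the product σ-algebra on tuples of unitaries the Borel one.
  have : SecondCountableTopology (Matrix (Fin d) (Fin d) ℂ) :=
    inferInstanceAs (SecondCountableTopology (Fin d → Fin d → ℂ))
  have : SecondCountableTopology (Matrix.unitaryGroup (Fin d) ℂ) :=
    TopologicalSpace.Subtype.secondCountableTopology _
  exact (measurable_pi_lambda (fun ω i => V i ω) hV)
    (isClosed_setOf_isRandomizing hN ε).measurableSet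

end Channel

/-! ### The union bound and the theorem. -/

theorem measureReal_not_isRandomizing_le {d N : ℕ} {ε : ℝ} (hd : 1 ≤ d) (hε : 0 < ε) (hε1 : ε < 1)
    (hN : 458752 * d / ε ^ 2 ≤ N) {Ω : Type*} [MeasurableSpace Ω] {P : Measure Ω}
    [IsProbabilityMeasure P] {U : Fin N → Ω → Matrix.unitaryGroup (Fin d) ℂ}
    (hU : ∀ i, IsHaarDistributed (U i) P) (hind : iIndepFun U P) :
    P.real {ω | ¬ IsRandomizing (averageConj fun i => U i ω) ε} ≤ Real.exp (-d) := by
  have hd1 : (1 : ℝ) ≤ d := by exact_mod_cast hd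
  have hNpos : (0 : ℝ) < N := lt_of_lt_of_le (by positivity) hN
  have hN0 : N ≠ 0 := by rintro rfl; simp at hNpos
  obtain ⟨s, hs, hcard, hnet⟩ :=
    exists_finset_net_unitSphere (EuclideanSpace ℂ (Fin d)) (δ := 1 / 8) (by norm_num)
  have hdim : Module.finrank ℝ (EuclideanSpace ℂ (Fin d)) = 2 * d := by
    rw [← Module.finrank_mul_finrank ℝ ℂ (EuclideanSpace ℂ (Fin d)), Complex.finrank_real_complex,
      finrank_euclideanSpace_fin]
  rw [hdim] at hcard
  let bad (p : EuclideanSpace ℂ (Fin d) × EuclideanSpace ℂ (Fin d)) : Set Ω :=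
    {ω | N * (ε / 2) ≤ |∑ i, (d * transitionProb (U i ω) p.1 p.2 - 1)|}
  have hsub : {ω | ¬ IsRandomizing (averageConj fun i => U i ω) ε} ⊆ ⋃ p ∈ s ×ˢ s, bad p := by
    intro ω hω
    by_contra hgood
    apply hω
    refine ⟨isQuantumChannel_averageConj _ hN0, fun ρ hρ =>
      norm_averageConj_sub_maxMixed_le _ (by positivity) (fun φ ψ hφ hψ => ?_) hρ⟩
    have hA : ∀ x ∈ s, ∀ y ∈ s, |deviation (fun i => U i ω) x y| ≤ ε / 2 / d := by
      intro x hx y hy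
      have hxy : ω ∉ bad (x, y) := fun hmem =>
        hgood (Set.mem_biUnion (Finset.mem_coe.2 (Finset.mk_mem_product hx hy)) hmem)
      simp only [bad, Set.mem_ofPred_eq, not_le] at hxy
      have heq : deviation (fun i => U i ω) x y =
          (N * d : ℝ)⁻¹ * ∑ i, (d * transitionProb (U i ω) x y - 1) := by
        rw [deviation, hs x hx, hs y hy, Finset.sum_sub_distrib, ← Finset.mul_sum]
        simp only [Finset.sum_const, Finset.card_univ, Fintype.card_fin, nsmul_eq_mul]
        field_simp
      rw [heq, abs_mul, abs_of_pos (by positivity)]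
      calc _ ≤ (N * d : ℝ)⁻¹ * (N * (ε / 2)) := by gcongr
        _ = _ := by field_simp
    calc _ ≤ 2 * (ε / 2 / d) := abs_deviation_le_of_net _ s hs hnet hA hφ hψ
      _ = ε / d := by ring
  have hbad (p) (hp : p ∈ s ×ˢ s) : P.real (bad p) ≤ 2 * Real.exp (-(14 * d)) := by
    rw [Finset.mem_product] at hp
    refine (measureReal_abs_average_transitionProb_ge_le hd hU hind (hs _ hp.1) (hs _ hp.2)
      (by positivity) (by linarith)).trans ?_
    -- `458752 = 14 * 4 * 8192`: the tail at `t = ε / 2` has exponent `N ε² / (4 * 8192) ≥ 14 d`.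
    have : 458752 * d ≤ N * ε ^ 2 := by rwa [div_le_iff₀ (by positivity)] at hN
    gcongr
    linarith
  -- `17 = 1 + 2 / (1/8)` in real dimension `2 d`. Pairs cost `exp (12 d)` and the factor `2` at
  -- most `exp d`, so `14 d` leaves `exp (-d)`.
  have he : (17 : ℝ) ≤ Real.exp 3 := by
    have h1 := Real.exp_one_gt_d9
    have h3 : Real.exp 3 = Real.exp 1 ^ 3 := by rw [← Real.exp_nat_mul]; norm_num
    rw [h3]
    calc (17 : ℝ) ≤ 2.6 ^ 3 := by norm_num
      _ ≤ _ := by gcongr; linarith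
  have hcard' : (s.card : ℝ) ≤ Real.exp (6 * d) := by
    calc (s.card : ℝ) ≤ 17 ^ (2 * d) := by norm_num at hcard ⊢; exact hcard
      _ ≤ Real.exp 3 ^ (2 * d) := by gcongr
      _ = _ := by rw [← Real.exp_nat_mul]; push_cast; ring_nf
  have htwo : (2 : ℝ) ≤ Real.exp d := by linarith [Real.add_one_le_exp (d : ℝ)]
  calc _ ≤ P.real (⋃ p ∈ s ×ˢ s, bad p) := measureReal_mono hsub (measure_ne_top P _)
    _ ≤ ∑ p ∈ s ×ˢ s, P.real (bad p) := measureReal_biUnion_finset_le _ _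
    _ ≤ ∑ _p ∈ s ×ˢ s, 2 * Real.exp (-(14 * d)) := Finset.sum_le_sum hbad
    _ = s.card * s.card * (2 * Real.exp (-(14 * d))) := by
        rw [Finset.sum_const, Finset.card_product, nsmul_eq_mul]; push_cast; rfl
    _ ≤ Real.exp (6 * d) * Real.exp (6 * d) * (Real.exp d * Real.exp (-(14 * d))) := by gcongr
    _ = Real.exp (-d) := by
        simp only [← Real.exp_add]; ring_nf

theorem theorem1 :
    ∃ C c : ℝ, 0 < C ∧ 0 < c ∧
      ∀ (d N : ℕ) (ε : ℝ), 1 ≤ d → 0 < ε → ε < 1 → C * d / ε ^ 2 ≤ N →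
      ∀ (Ω : Type*) [MeasurableSpace Ω] (P : Measure Ω) [IsProbabilityMeasure P]
        (U : Fin N → Ω → Matrix.unitaryGroup (Fin d) ℂ),
        (∀ i, IsHaarDistributed (U i) P) → iIndepFun U P →
        MeasurableSet {ω | IsRandomizing (averageConj fun i => U i ω) ε} ∧
        0 < P {ω | IsRandomizing (averageConj fun i => U i ω) ε} ∧
        P {ω | ¬ IsRandomizing (averageConj fun i => U i ω) ε} ≤
          ENNReal.ofReal (Real.exp (-c * d)) := by
  refine ⟨458752, 1, by norm_num, one_pos, ?_⟩
  intro d N ε hd hε hε1 hN Ω _ P _ U hU hind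
  have hd1 : (1 : ℝ) ≤ d := by exact_mod_cast hd
  have hNpos : (0 : ℝ) < N := lt_of_lt_of_le (by positivity) hN
  have hN0 : N ≠ 0 := by rintro rfl; simp at hNpos
  have hmeas : MeasurableSet {ω | IsRandomizing (averageConj fun i => U i ω) ε} :=
    measurableSet_isRandomizing hN0 ε fun i => (hU i).measurable
  have hbad := measureReal_not_isRandomizing_le hd hε hε1 hN hU hind
  refine ⟨hmeas, ?_, ?_⟩
  · have hcompl := probReal_compl_eq_one_sub (μ := P) hmeas
    have hlt : Real.exp (-d) < 1 := Real.exp_lt_one_iff.2 (by linarith)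
    have hreal : 0 < P.real {ω | IsRandomizing (averageConj fun i => U i ω) ε} := by
      rw [Set.compl_ofPred] at hcompl
      linarith
    exact (ENNReal.toReal_pos_iff.1 hreal).1
  · rw [neg_one_mul, ← ENNReal.ofReal_toReal (measure_ne_top P _)]
    exact ENNReal.ofReal_le_ofReal hbad
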